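/- Let $K\ge 2$, $R>0$, $\theta>0$ and $d_1>d_2>\dots>d_K>0$. Let $\Delta^{K-1}=\{v\in\mathbb R^K: v_i\ge 0,\ \sum_i v_i=1\}$, let $$t(v)=\exp\Big(-\frac{2^{R/v}-1}{2^R-1}\,\theta\Big)\quad(0<v\le 1),\qquad t(0)=0,\qquad T(v)=\sum_{i=1}^K t(v_i)\,d_i ,$$ and consider the orthogonal resource allocation (ORA) problem $\max_{v\in\Delta^{K-1}}T(v)$. Put $$\theta_c=\frac{2^R-1}{2^R}\Big(\frac{2}{R\ln 2}+1\Big),\qquad \mathscr U(v)=\frac{2^{R/v}}{v^2}\,t(v)\ (0<v\le1),\quad \mathscr U(0)=0,\qquad M=\max_{[0,1]}\mathscr U,$$ let $v_{\rm int}\in[0,1]$ be the point with $\mathscr U(v_{\rm int})=M$, and for $C\in[2^Re^{-\theta},M]$ let $V^+_{R,\theta}(C)$ and $V^-_{R,\theta}(C)$ be the solutions of $\mathscr U(v)=C$ in $[v_{\rm int},1]$ and in $[0,v_{\rm int}]$. Put $$\ell_{\rm ORA}=\max\Big\{1\le i\le K: d_i\ge \tfrac{2^Re^{-\theta}}{M}d_1\Big\},\qquad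 \mathscr C_i(\lambda)=\frac{\lambda(2^R-1)}{\theta d_iR\ln 2},$$ $$\lambda_{\rm low}=\frac{2^Re^{-\theta}\theta d_1R\ln 2}{2^R-1},\qquad \lambda_{\rm upp}(\ell)=\frac{M\theta d_\ell R\ln2}{2^R-1},$$ $$S^+_\ell(\lambda)=\sum_{i=1}^{\ell}V^+_{R,\theta}(\mathscr C_i(\lambda)),\qquad S^-_\ell(\lambda)=V^-_{R,\theta}(\mathscr C_\ell(\lambda))+\sum_{i=1}^{\ell-1}V^+_{R,\theta}(\mathscr C_i(\lambda)).$$ Algorithm (exact real arithmetic; ties in an $\arg\max$ broken arbitrarily). If $\theta\ge\theta_c$, return $(1,0,\dots,0)$. Otherwise, for each $\ell\in\{2,\dots,\ell_{\rm ORA}\}$ start with $\mathcal C_\ell=\emptyset$ and do the following. (a) If $S^+_\ell(\lambda_{\rm low})\ge1\ge S^+_\ell(\lambda_{\rm upp}(\ell))$, find the unique $\lambda^+\in[\lambda_{\rm low},\lambda_{\rm upp}(\ell)]$ with $S^+_\ell(\lambda^+)=1$ and add to $\mathcal C_\ell$ the vector with coordinates $V^+_{R,\theta}(\mathscr C_i(\lambda^+))$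 for $i\le\ell$ and $0$ for $i>\ell$. (b) If $S^+_\ell(\lambda_{\rm low})\ge1$, find all the finitely many roots $\lambda^-\in[\lambda_{\rm low},\lambda_{\rm upp}(\ell)]$ of $S^-_\ell(\lambda^-)=1$ and, for each of them, add to $\mathcal C_\ell$ the vector with coordinates $V^+_{R,\theta}(\mathscr C_i(\lambda^-))$ for $i<\ell$, $V^-_{R,\theta}(\mathscr C_\ell(\lambda^-))$ for $i=\ell$, and $0$ for $i>\ell$. (c) Let $v^{(\ell)}=(0,\dots,0)$ if $\mathcal C_\ell=\emptyset$, and otherwise $v^{(\ell)}\in\arg\max_{v\in\mathcal C_\ell}T(v)$. Finally set $v^{(1)}=(1,0,\dots,0)$ and return a $v^{(\ell)}$, $1\le\ell\le\ell_{\rm ORA}$, with the largest value of $T$. Theorem. (i) If $\theta<\theta_c$, then the maximum $M$ is attained at exactly one point $v_{\rm int}$ of $[0,1]$, and for every $C\in[2^Re^{-\theta},M]$ the equation $\mathscr U(v)=C$ has exactly one solution in $[v_{\rm int},1]$ and exactly one in $[0,v_{\rm int}]$. (ii) All steps of the algorithm can be carried out (in particular $\lambda^+$ in (a) exists and is unique,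 and in (b) there are only finitely many roots), so that it returns a vector, and every vector that it can return is a global maximizer of $T$ over $\Delta^{K-1}$. (iii) Every global maximizer $v$ of $T$ over $\Delta^{K-1}$ is either $(1,0,\dots,0)$ or there are $2\le\ell\le\ell_{\rm ORA}$ and $\lambda\in[\lambda_{\rm low},\lambda_{\rm upp}(\ell)]$ such that $v_i=V^+_{R,\theta}(\mathscr C_i(\lambda))$ for $i<\ell$, $v_\ell\in\{V^+_{R,\theta}(\mathscr C_\ell(\lambda)),V^-_{R,\theta}(\mathscr C_\ell(\lambda))\}$, $v_i=0$ for $i>\ell$, and $\sum_{i=1}^{\ell}v_i=1$. -/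

import Mathlib

/-! Orthogonal resource allocation: the objective, the functions `V⁺`, `V⁻`, and the global
maximization algorithm.  Blocks are indexed by `Fin K`, so the block with 1-based number `ℓ` is the
index `k : Fin K` with `k + 1 = ℓ`. -/

noncomputable section

namespace ORA

/-- Success probability of a block that gets the fraction `v` of the channel, with `t 0 = 0`. -/
def t (R θ v : ℝ) : ℝ :=
  if v = 0 then 0 else Real.exp (-(((2 : ℝ) ^ (R / v) - 1) / ((2 : ℝ) ^ R - 1) * θ))

/-- The objective `T(v) = ∑ t(v_i) d_i`. -/
def T {K : ℕ} (R θ : ℝ) (d v : Fin K → ℝ) : ℝ := ∑ i, t R θ (v i) * d i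

/-- `v` is an optimal solution of `max_{v ∈ Δ^{K-1}} T(v)`. -/
def IsMaximizer {K : ℕ} (R θ : ℝ) (d v : Fin K → ℝ) : Prop :=
  v ∈ stdSimplex ℝ (Fin K) ∧ IsMaxOn (T R θ d) (stdSimplex ℝ (Fin K)) v

/-- The threshold `θ_c`. -/
def thetaC (R : ℝ) : ℝ := ((2 : ℝ) ^ R - 1) / (2 : ℝ) ^ R * (2 / (R * Real.log 2) + 1)

/-- The function `𝒰` on `[0, 1]`, with `𝒰(0) = 0`. -/
def U (R θ v : ℝ) : ℝ :=
  if v = 0 then 0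
  else (2 : ℝ) ^ (R / v) / v ^ 2 * Real.exp (-(((2 : ℝ) ^ (R / v) - 1) / ((2 : ℝ) ^ R - 1) * θ))

/-- `M*_int`, the maximum of `𝒰` over `[0, 1]`. -/
def M (R θ : ℝ) : ℝ := sSup (U R θ '' Set.Icc 0 1)

/-- `v*_int`, the point of `[0, 1]` at which `𝒰` attains `M*_int`. -/
def vInt (R θ : ℝ) : ℝ := Function.invFunOn (U R θ) (Set.Icc 0 1) (M R θ)

/-- `V⁺(C)`, the solution of `𝒰(v) = C` in `[v*_int, 1]`. -/
def Vplus (R θ C : ℝ) : ℝ := Function.invFunOn (U R θ) (Set.Icc (vInt R θ) 1) C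

/-- `V⁻(C)`, the solution of `𝒰(v) = C` in `[0, v*_int]`. -/
def Vminus (R θ C : ℝ) : ℝ := Function.invFunOn (U R θ) (Set.Icc 0 (vInt R θ)) C

/-- `ℓ_ORA = max {1 ≤ i ≤ K : d_i ≥ (2^R e^{-θ} / M*_int) d_1}` (1-based). -/
def ellORA {K : ℕ} [NeZero K] (R θ : ℝ) (d : Fin K → ℝ) : ℕ :=
  (Finset.univ.filter
    (fun i : Fin K => (2 : ℝ) ^ R * Real.exp (-θ) / M R θ * d 0 ≤ d i)).sup (fun i => (i : ℕ) + 1)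

/-- `𝒞_i(λ)`. -/
def Cfun {K : ℕ} (R θ : ℝ) (d : Fin K → ℝ) (i : Fin K) (lam : ℝ) : ℝ :=
  lam * ((2 : ℝ) ^ R - 1) / (θ * d i * R * Real.log 2)

/-- `λ_low`. -/
def lamLow {K : ℕ} [NeZero K] (R θ : ℝ) (d : Fin K → ℝ) : ℝ :=
  (2 : ℝ) ^ R * Real.exp (-θ) * θ * d 0 * R * Real.log 2 / ((2 : ℝ) ^ R - 1)

/-- `λ_upp(ℓ)`, where `k` is the index of block `ℓ`. -/
def lamUpp {K : ℕ} (R θ : ℝ) (d : Fin K → ℝ) (k : Fin K) : ℝ :=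
  M R θ * θ * d k * R * Real.log 2 / ((2 : ℝ) ^ R - 1)

/-- The search interval `[λ_low, λ_upp(ℓ)]`. -/
def lamRange {K : ℕ} [NeZero K] (R θ : ℝ) (d : Fin K → ℝ) (k : Fin K) : Set ℝ :=
  Set.Icc (lamLow R θ d) (lamUpp R θ d k)

/-- `S_ℓ⁺(λ)`. -/
def Splus {K : ℕ} (R θ : ℝ) (d : Fin K → ℝ) (k : Fin K) (lam : ℝ) : ℝ :=
  ∑ i ∈ Finset.Iic k, Vplus R θ (Cfun R θ d i lam)

/-- `S_ℓ⁻(λ)`. -/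
def Sminus {K : ℕ} (R θ : ℝ) (d : Fin K → ℝ) (k : Fin K) (lam : ℝ) : ℝ :=
  Vminus R θ (Cfun R θ d k lam) + ∑ i ∈ Finset.Iio k, Vplus R θ (Cfun R θ d i lam)

/-- The vector with entries `V⁺(𝒞_i(λ))` for `i ≤ ℓ` and `0` afterwards. -/
def candPlus {K : ℕ} (R θ : ℝ) (d : Fin K → ℝ) (k : Fin K) (lam : ℝ) : Fin K → ℝ := fun i =>
  if i ≤ k then Vplus R θ (Cfun R θ d i lam) else 0

/-- The vector with entries `V⁺(𝒞_i(λ))` for `i < ℓ`, `V⁻(𝒞_ℓ(λ))` for `i = ℓ`, and `0`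
afterwards. -/
def candMinus {K : ℕ} (R θ : ℝ) (d : Fin K → ℝ) (k : Fin K) (lam : ℝ) : Fin K → ℝ := fun i =>
  if i < k then Vplus R θ (Cfun R θ d i lam)
  else if i = k then Vminus R θ (Cfun R θ d k lam)
  else 0

/-- The vector `(1, 0, …, 0)`. -/
def e1 {K : ℕ} [NeZero K] : Fin K → ℝ := Pi.single 0 1

/-- First phase of round `ℓ`: `A` is the set of candidates that it adds.  If
`S_ℓ⁺(λ_low) ≥ 1 ≥ S_ℓ⁺(λ_upp(ℓ))`, it finds the unique root of `S_ℓ⁺ = 1` in the search interval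
and adds the corresponding vector; otherwise it adds nothing. -/
def PlusPhase {K : ℕ} [NeZero K] (R θ : ℝ) (d : Fin K → ℝ) (k : Fin K)
    (A : Set (Fin K → ℝ)) : Prop :=
  if 1 ≤ Splus R θ d k (lamLow R θ d) ∧ Splus R θ d k (lamUpp R θ d k) ≤ 1 then
    ∃ lam ∈ lamRange R θ d k, Splus R θ d k lam = 1 ∧
      (∀ lam' ∈ lamRange R θ d k, Splus R θ d k lam' = 1 → lam' = lam) ∧
      A = {candPlus R θ d k lam}
  else A = ∅

/-- Second phase of round `ℓ`: `B` is the set of candidates that it adds.  If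
`S_ℓ⁺(λ_low) ≥ 1`, it finds the finite list of all roots of `S_ℓ⁻ = 1` in the search interval
and adds the corresponding vectors; otherwise it adds nothing. -/
def MinusPhase {K : ℕ} [NeZero K] (R θ : ℝ) (d : Fin K → ℝ) (k : Fin K)
    (B : Set (Fin K → ℝ)) : Prop :=
  if 1 ≤ Splus R θ d k (lamLow R θ d) then
    ∃ roots : Finset ℝ,
      (∀ lam, lam ∈ roots ↔ lam ∈ lamRange R θ d k ∧ Sminus R θ d k lam = 1) ∧
      B = {v | ∃ lam ∈ roots, v = candMinus R θ d k lam}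
  else B = ∅

open Classical in
/-- `w` is a possible value of `v^(ℓ)` after round `ℓ` of the loop: the zero vector if there is no
candidate, otherwise a candidate of largest objective value. -/
def Round {K : ℕ} [NeZero K] (R θ : ℝ) (d : Fin K → ℝ) (k : Fin K) (w : Fin K → ℝ) : Prop :=
  ∃ A B : Set (Fin K → ℝ), PlusPhase R θ d k A ∧ MinusPhase R θ d k B ∧
    if A ∪ B = ∅ then w = 0
    else w ∈ A ∪ B ∧ IsMaxOn (T R θ d) (A ∪ B) w

/-- `v` is a possible return value of the algorithm on input `R`, `θ`, `d`; ties in an `argmax` may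
be broken in any way.  `w k` is the vector `v^(ℓ)` with `ℓ = k + 1`. -/
def AlgorithmReturns {K : ℕ} [NeZero K] (R θ : ℝ) (d : Fin K → ℝ) (v : Fin K → ℝ) : Prop :=
  if thetaC R ≤ θ then v = e1
  else ∃ w : Fin K → (Fin K → ℝ),
    (∀ k : Fin K, 2 ≤ (k : ℕ) + 1 → (k : ℕ) + 1 ≤ ellORA R θ d → Round R θ d k (w k)) ∧
    w 0 = e1 ∧
    ∃ k : Fin K, (k : ℕ) + 1 ≤ ellORA R θ d ∧ v = w k ∧
      ∀ j : Fin K, (j : ℕ) + 1 ≤ ellORA R θ d → T R θ d (w j) ≤ T R θ d (w k)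

end ORA

end

namespace ORA

open Set Filter Topology

/-! The derivative of `t` is a positive constant (`rate`) times `U`. In the variable x = R ln 2 / v,
log `U` has the strictly decreasing derivative 1 + 2/x - c e^x up to an additive constant in log
`U`, so `U` rises to a single peak and then falls. The peak lies inside (0, 1) exactly when θ < θ_c
(`lt_thetaC_iff`, `vInt_spec`), and `t` is strictly convex to its left.

A maximizer exists by compactness. Comparing it with vectors that differ in two coordinates
(`IsMaximizer.pair_le`) shows that its entries decrease, that at most one positive entry lies
strictly left of the peak, and that U(v_i) d_i is the same for all positive entries. So the last
block in use lies on either branch of the inverse of `U`, and all earlier ones on the right branch: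
these are the candidates of the algorithm (`IsMaximizer.eq_e1_or_cand`). If θ ≥ θ_c, then `t` is
strictly convex on [0, 1] and only (1, 0, …, 0) survives.

The delicate point is that S⁻ = 1 has finitely many roots. As a function of the share w of the last
block, the total `branchSum` is real analytic up to the peak. Infinitely many roots would make it
constant, but its derivative at the peak is 1, because `U` is stationary there (`branchSum_finite`).
-/

/-! ### Exponential form of the functions -/

theorem two_rpow_div (R v : ℝ) : (2 : ℝ) ^ (R / v) = Real.exp (R * Real.log 2 / v) := by
  rw [Real.rpow_def_of_pos two_pos]; congr 1; ring

theorem mul_log_two_pos {R : ℝ} (hR : 0 < R) : 0 < R * Real.log 2 :=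
  mul_pos hR (Real.log_pos one_lt_two)

theorem two_rpow_sub_one_pos {R : ℝ} (hR : 0 < R) : 0 < (2 : ℝ) ^ R - 1 :=
  sub_pos.2 (Real.one_lt_rpow one_lt_two hR)

/-- The coefficient `θ / (2^R - 1)` in the exponent of `t`. -/
noncomputable def coef (R θ : ℝ) : ℝ := θ / ((2 : ℝ) ^ R - 1)

/-- The factor relating `t'` and `𝒰`. -/
noncomputable def rate (R θ : ℝ) : ℝ := coef R θ * (R * Real.log 2)

theorem coef_pos {R θ : ℝ} (hR : 0 < R) (hθ : 0 < θ) : 0 < coef R θ :=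
  div_pos hθ (two_rpow_sub_one_pos hR)

theorem rate_pos {R θ : ℝ} (hR : 0 < R) (hθ : 0 < θ) : 0 < rate R θ :=
  mul_pos (coef_pos hR hθ) (mul_log_two_pos hR)

theorem t_zero (R θ : ℝ) : t R θ 0 = 0 := by simp [t]

theorem U_zero (R θ : ℝ) : U R θ 0 = 0 := by simp [U]

theorem t_of_ne {R θ v : ℝ} (hv : v ≠ 0) :
    t R θ v = Real.exp (-(coef R θ * (Real.exp (R * Real.log 2 / v) - 1))) := by
  rw [t, if_neg hv, two_rpow_div, coef]; congr 1; ring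

theorem U_of_ne {R θ v : ℝ} (hv : v ≠ 0) :
    U R θ v = Real.exp (R * Real.log 2 / v) / v ^ 2 *
      Real.exp (-(coef R θ * (Real.exp (R * Real.log 2 / v) - 1))) := by
  rw [U, if_neg hv, two_rpow_div, coef]; congr 2; ring

theorem U_one (R θ : ℝ) (hR : 0 < R) : U R θ 1 = (2 : ℝ) ^ R * Real.exp (-θ) := by
  have h := (two_rpow_sub_one_pos hR).ne'
  simp [U, div_self h]

theorem U_pos {R θ v : ℝ} (hv : 0 < v) : 0 < U R θ v := by
  rw [U_of_ne hv.ne']; positivity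

theorem t_pos {R θ v : ℝ} (hv : v ≠ 0) : 0 < t R θ v := by
  rw [t_of_ne hv]; positivity

/-! ### Derivatives and continuity -/

theorem hasDerivAt_t (R θ : ℝ) {v : ℝ} (hv : v ≠ 0) :
    HasDerivAt (t R θ) (rate R θ * U R θ v) v := by
  have h1 : HasDerivAt (fun v : ℝ => R * Real.log 2 / v) (-(R * Real.log 2) / v ^ 2) v := by
    simpa [div_eq_mul_inv] using (hasDerivAt_inv hv).const_mul (R * Real.log 2)
  have h2 := (((h1.exp.sub_const 1).const_mul (coef R θ)).neg).exp
  refine (h2.congr_deriv ?_).congr_of_eventuallyEq ?_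
  · rw [U_of_ne hv, rate]; simp only [Pi.neg_apply]; ring
  · filter_upwards [isOpen_ne.mem_nhds hv] with w hw using t_of_ne hw

theorem tendsto_param {R : ℝ} (hR : 0 < R) :
    Tendsto (fun v : ℝ => Real.exp (R * Real.log 2 / v)) (𝓝[>] 0) atTop := by
  refine Real.tendsto_exp_atTop.comp ?_
  exact (tendsto_inv_nhdsGT_zero.const_mul_atTop (mul_log_two_pos hR)).congr fun v =>
    (div_eq_mul_inv _ _).symm

/-- With y = exp(R ln 2 / v), the limit v → 0⁺ becomes y → ∞; the case n = 0 gives continuity of `t`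
at 0, and n = 3 that of `U`. -/
theorem tendsto_pow_mul_exp {c : ℝ} (hc : 0 < c) (n : ℕ) :
    Tendsto (fun y : ℝ => y ^ n * Real.exp (-(c * (y - 1)))) atTop (𝓝 0) := by
  have h := (tendsto_rpow_mul_exp_neg_mul_atTop_nhds_zero n c hc).mul_const (Real.exp c)
  simp only [Real.rpow_natCast, zero_mul] at h
  refine h.congr fun y => ?_
  rw [mul_assoc, ← Real.exp_add]; congr 2; ring

theorem continuousOn_Ici_of {f : ℝ → ℝ} (h : ∀ v, 0 < v → ContinuousAt f v)
    (h0 : Tendsto f (𝓝[>] 0) (𝓝 (f 0))) : ContinuousOn f (Ici 0) := by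
  intro v hv
  rcases (mem_Ici.1 hv).eq_or_lt with rfl | hv
  · exact continuousWithinAt_Ioi_iff_Ici.1 h0
  · exact (h v hv).continuousWithinAt

theorem continuousOn_t {R θ : ℝ} (hR : 0 < R) (hθ : 0 < θ) :
    ContinuousOn (t R θ) (Ici 0) := by
  refine continuousOn_Ici_of (fun v hv => (hasDerivAt_t R θ hv.ne').continuousAt) ?_
  have h := (tendsto_pow_mul_exp (coef_pos hR hθ) 0).comp (tendsto_param hR)
  rw [t_zero]
  refine h.congr' ?_
  filter_upwards [self_mem_nhdsWithin] with v hv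
  simp [t_of_ne (ne_of_gt hv)]

theorem analyticAt_U (R θ : ℝ) {v : ℝ} (hv : v ≠ 0) : AnalyticAt ℝ (U R θ) v := by
  have h1 : AnalyticAt ℝ (fun v : ℝ => R * Real.log 2 / v) v :=
    analyticAt_const.div analyticAt_id hv
  have h2 : AnalyticAt ℝ (fun v : ℝ => Real.exp (R * Real.log 2 / v) / v ^ 2 *
      Real.exp (-(coef R θ * (Real.exp (R * Real.log 2 / v) - 1)))) v :=
    (h1.rexp.div (analyticAt_id.pow 2) (pow_ne_zero 2 hv)).mul
      (analyticAt_const.mul (h1.rexp.sub analyticAt_const)).neg.rexp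
  refine h2.congr ?_
  filter_upwards [isOpen_ne.mem_nhds hv] with w hw using (U_of_ne hw).symm

theorem continuousOn_U {R θ : ℝ} (hR : 0 < R) (hθ : 0 < θ) :
    ContinuousOn (U R θ) (Ici 0) := by
  refine continuousOn_Ici_of (fun v hv => (analyticAt_U R θ hv.ne').continuousAt) ?_
  have ha := mul_log_two_pos hR
  have h := ((tendsto_pow_mul_exp (coef_pos hR hθ) 3).comp (tendsto_param hR)).const_mul
    (2 / (R * Real.log 2) ^ 2)
  rw [mul_zero] at h
  rw [U_zero]
  refine squeeze_zero' ?_ ?_ h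
  · filter_upwards [self_mem_nhdsWithin] with v hv using (U_pos hv).le
  · filter_upwards [self_mem_nhdsWithin] with v hv
    have hv : 0 < v := hv
    have hx : 0 < R * Real.log 2 / v := div_pos ha hv
    rw [U_of_ne hv.ne']
    simp only [Function.comp]
    rw [← mul_assoc]
    refine mul_le_mul_of_nonneg_right ?_ (Real.exp_pos _).le
    -- With x = R ln 2 / v and y = e^x, the bound x² ≤ 2y turns the factor y / v² into at most 2y² /
    -- (R ln 2)², and y ≥ 1 leaves room for the power y³.
    have hq := Real.quadratic_le_exp_of_nonneg hx.le
    have h1 : 1 ≤ Real.exp (R * Real.log 2 / v) := Real.one_le_exp hx.le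
    have h2 : (R * Real.log 2 / v) ^ 2 ≤ 2 * Real.exp (R * Real.log 2 / v) := by nlinarith
    have h3 : Real.exp (R * Real.log 2 / v) / v ^ 2 =
        Real.exp (R * Real.log 2 / v) * (R * Real.log 2 / v) ^ 2 / (R * Real.log 2) ^ 2 := by
      field_simp
    rw [h3, div_mul_eq_mul_div]
    refine div_le_div_of_nonneg_right ?_ (by positivity)
    nlinarith [mul_le_mul_of_nonneg_left h2 (Real.exp_pos (R * Real.log 2 / v)).le,
      mul_nonneg (sub_nonneg.2 h1) (sq_nonneg (Real.exp (R * Real.log 2 / v)))]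

/-! ### Unimodality of `𝒰` -/

/-- The logarithm of `(R ln 2)^2 𝒰`, as a function of `x = R ln 2 / v`. -/
noncomputable def logU (c x : ℝ) : ℝ := x + 2 * Real.log x - c * (Real.exp x - 1)

/-- The derivative of `logU`. -/
noncomputable def slopeU (c x : ℝ) : ℝ := 1 + 2 / x - c * Real.exp x

theorem hasDerivAt_logU (c : ℝ) {x : ℝ} (hx : x ≠ 0) : HasDerivAt (logU c) (slopeU c x) x := by
  have h := ((hasDerivAt_id x).add ((Real.hasDerivAt_log hx).const_mul 2)).sub
    (((Real.hasDerivAt_exp x).sub_const 1).const_mul c)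
  simpa [logU, slopeU, div_eq_mul_inv] using! h

/-- Hence the slope changes sign at most once, which is the source of the unimodality of `U`. -/
theorem slopeU_strictAntiOn {c : ℝ} (hc : 0 < c) : StrictAntiOn (slopeU c) (Ioi 0) := by
  intro x hx y hy hxy
  have h1 : 2 / y < 2 / x := div_lt_div_of_pos_left two_pos hx hxy
  have h2 := mul_lt_mul_of_pos_left (Real.exp_lt_exp.2 hxy) hc
  unfold slopeU; linarith

theorem logU_strictMonoOn {c x₀ : ℝ} (hc : 0 < c) (h : 0 ≤ slopeU c x₀) :
    StrictMonoOn (logU c) (Ioc 0 x₀) := by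
  refine strictMonoOn_of_deriv_pos (convex_Ioc 0 x₀)
    (fun x hx => (hasDerivAt_logU c hx.1.ne').continuousAt.continuousWithinAt) fun x hx => ?_
  rw [interior_Ioc] at hx
  rw [(hasDerivAt_logU c hx.1.ne').deriv]
  exact h.trans_lt (slopeU_strictAntiOn hc hx.1 (hx.1.trans hx.2) hx.2)

theorem logU_strictAntiOn {c x₀ : ℝ} (hc : 0 < c) (hx₀ : 0 < x₀) (h : slopeU c x₀ ≤ 0) :
    StrictAntiOn (logU c) (Ici x₀) := by
  refine strictAntiOn_of_deriv_neg (convex_Ici x₀)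
    (fun x hx => (hasDerivAt_logU c (hx₀.trans_le hx).ne').continuousAt.continuousWithinAt)
    fun x hx => ?_
  rw [interior_Ici] at hx
  rw [(hasDerivAt_logU c (hx₀.trans hx).ne').deriv]
  exact (slopeU_strictAntiOn hc hx₀ (hx₀.trans hx) hx).trans_le h

theorem U_eq_exp_logU {R : ℝ} (θ : ℝ) (hR : 0 < R) {v : ℝ} (hv : 0 < v) :
    U R θ v = Real.exp (logU (coef R θ) (R * Real.log 2 / v)) / (R * Real.log 2) ^ 2 := by
  have ha := mul_log_two_pos hR
  have hx : 0 < R * Real.log 2 / v := div_pos ha hv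
  have h2 : Real.exp (2 * Real.log (R * Real.log 2 / v)) = (R * Real.log 2 / v) ^ 2 := by
    rw [two_mul, Real.exp_add, Real.exp_log hx, sq]
  rw [U_of_ne hv.ne', logU, sub_eq_add_neg (_ + _), Real.exp_add, Real.exp_add, h2]
  field_simp

/-- The substitution x = R ln 2 / v reverses order, so `logU` increasing up to R ln 2 / p means `U`
decreasing from p on. -/
theorem U_strictAntiOn {R θ p : ℝ} (hR : 0 < R) (hθ : 0 < θ) (hp : 0 < p)
    (h : 0 ≤ slopeU (coef R θ) (R * Real.log 2 / p)) : StrictAntiOn (U R θ) (Ici p) := by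
  have ha := mul_log_two_pos hR
  intro v hv w hw hvw
  have hv0 := hp.trans_le hv
  have hw0 := hp.trans_le hw
  rw [U_eq_exp_logU θ hR hv0, U_eq_exp_logU θ hR hw0]
  refine div_lt_div_of_pos_right (Real.exp_lt_exp.2 ?_) (by positivity)
  exact logU_strictMonoOn (coef_pos hR hθ) h
    ⟨by positivity, div_le_div_of_nonneg_left ha.le hp hw⟩
    ⟨by positivity, div_le_div_of_nonneg_left ha.le hp hv⟩
    (div_lt_div_of_pos_left ha hv0 hvw)

theorem U_strictMonoOn {R θ p : ℝ} (hR : 0 < R) (hθ : 0 < θ) (hp : 0 < p)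
    (h : slopeU (coef R θ) (R * Real.log 2 / p) ≤ 0) : StrictMonoOn (U R θ) (Icc 0 p) := by
  have ha := mul_log_two_pos hR
  intro v hv w hw hvw
  rcases hv.1.eq_or_lt with rfl | hv0
  · rw [U_zero]; exact U_pos hvw
  have hw0 := hv0.trans hvw
  rw [U_eq_exp_logU θ hR hv0, U_eq_exp_logU θ hR hw0]
  refine div_lt_div_of_pos_right (Real.exp_lt_exp.2 ?_) (by positivity)
  exact logU_strictAntiOn (coef_pos hR hθ) (by positivity) h
    (div_le_div_of_nonneg_left ha.le hw0 hw.2) (div_le_div_of_nonneg_left ha.le hv0 hv.2)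
    (div_lt_div_of_pos_left ha hv0 hvw)

theorem hasDerivAt_U {R : ℝ} (θ : ℝ) (hR : 0 < R) {v : ℝ} (hv : 0 < v) :
    HasDerivAt (U R θ)
      (-(U R θ v * slopeU (coef R θ) (R * Real.log 2 / v) * (R * Real.log 2 / v ^ 2))) v := by
  have ha := mul_log_two_pos hR
  have h1 : HasDerivAt (fun v : ℝ => R * Real.log 2 / v) (-(R * Real.log 2) / v ^ 2) v := by
    simpa [div_eq_mul_inv] using (hasDerivAt_inv hv.ne').const_mul (R * Real.log 2)
  have h2 := (((hasDerivAt_logU (coef R θ) (div_pos ha hv).ne').comp v h1).exp).div_const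
    ((R * Real.log 2) ^ 2)
  refine (h2.congr_deriv ?_).congr_of_eventuallyEq ?_
  · rw [U_eq_exp_logU θ hR hv]; simp only [Function.comp]; ring
  · filter_upwards [isOpen_Ioi.mem_nhds hv] with w hw using U_eq_exp_logU θ hR hw

/-- The value v = 1 corresponds to x = R ln 2, and θ_c is the θ at which the slope vanishes there.
Below it, `U` is still decreasing at v = 1, so the peak is interior. -/
theorem lt_thetaC_iff {R θ : ℝ} (hR : 0 < R) :
    θ < thetaC R ↔ 0 < slopeU (coef R θ) (R * Real.log 2) := by
  have ha := mul_log_two_pos hR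
  have hs := two_rpow_sub_one_pos hR
  have he : Real.exp (R * Real.log 2) = (2 : ℝ) ^ R := by
    rw [Real.rpow_def_of_pos two_pos, mul_comm]
  have h2 : (0 : ℝ) < 2 ^ R := by positivity
  rw [thetaC, slopeU, coef, he, sub_pos, div_mul_eq_mul_div, div_mul_eq_mul_div, lt_div_iff₀ h2,
    div_lt_iff₀ hs]
  constructor <;> intro h <;> linarith

theorem exists_slopeU_eq_zero {c a : ℝ} (hc : 0 < c) (ha : 0 < a) (h : 0 < slopeU c a) :
    ∃ x, a < x ∧ slopeU c x = 0 := by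
  -- The choice gives c b ≥ 1 + 2/a ≥ 1 + 2/b, and e^b ≥ b + 1 then makes the slope at b
  -- nonpositive.
  set b := max a ((1 + 2 / a) / c) with hb
  have hab : a ≤ b := le_max_left _ _
  have hb' : slopeU c b ≤ 0 := by
    have h1 : 1 + 2 / a ≤ c * b := by
      rw [mul_comm, ← div_le_iff₀ hc]; exact le_max_right _ _
    have h2 : 2 / b ≤ 2 / a := div_le_div_of_nonneg_left two_pos.le ha hab
    have h3 := mul_le_mul_of_nonneg_left (Real.add_one_le_exp b) hc.le
    unfold slopeU; nlinarith
  have hcont : ContinuousOn (slopeU c) (Icc a b) := by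
    unfold slopeU
    refine ContinuousOn.sub (continuousOn_const.add (continuousOn_const.div continuousOn_id
      fun x hx => (ha.trans_le hx.1).ne')) (by fun_prop)
  obtain ⟨x, hx, hx0⟩ := intermediate_value_Icc' hab hcont ⟨hb', h.le⟩
  refine ⟨x, hx.1.lt_of_ne ?_, hx0⟩
  rintro rfl
  exact h.ne' hx0

/-! ### The functions `V⁺` and `V⁻` below the threshold -/

/-- The zero x of the slope gives the strict peak p = R ln 2 / x; its uniqueness identifies the
point selected by `invFunOn` with p. -/
theorem vInt_spec {R θ : ℝ} (hR : 0 < R) (hθ : 0 < θ) (hlt : θ < thetaC R) :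
    0 < vInt R θ ∧ vInt R θ < 1 ∧ slopeU (coef R θ) (R * Real.log 2 / vInt R θ) = 0 ∧
      M R θ = U R θ (vInt R θ) ∧ IsGreatest (U R θ '' Icc 0 1) (M R θ) ∧
      ∀ v ∈ Icc (0 : ℝ) 1, U R θ v = M R θ → v = vInt R θ := by
  have ha := mul_log_two_pos hR
  obtain ⟨x, hax, hx⟩ := exists_slopeU_eq_zero (coef_pos hR hθ) ha ((lt_thetaC_iff hR).1 hlt)
  have hx0 := ha.trans hax
  set p := R * Real.log 2 / x with hp
  have hp0 : 0 < p := div_pos ha hx0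
  have hp1 : p < 1 := (div_lt_one hx0).2 hax
  have hpx : R * Real.log 2 / p = x := by rw [hp]; field_simp
  have hmono := U_strictMonoOn hR hθ hp0 (hpx ▸ hx.le)
  have hanti := U_strictAntiOn hR hθ hp0 (hpx ▸ hx.ge)
  have hlt' : ∀ v ∈ Icc (0 : ℝ) 1, v ≠ p → U R θ v < U R θ p := fun v hv hvp => by
    rcases lt_or_gt_of_ne hvp with h | h
    · exact hmono ⟨hv.1, h.le⟩ ⟨hp0.le, le_rfl⟩ h
    · exact hanti self_mem_Ici h.le h
  have hgr : IsGreatest (U R θ '' Icc 0 1) (U R θ p) := by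
    refine ⟨⟨p, ⟨hp0.le, hp1.le⟩, rfl⟩, ?_⟩
    rintro _ ⟨v, hv, rfl⟩
    by_cases hvp : v = p
    · rw [hvp]
    · exact (hlt' v hv hvp).le
  have hM : M R θ = U R θ p := hgr.csSup_eq
  have huniq : ∀ v ∈ Icc (0 : ℝ) 1, U R θ v = M R θ → v = p := fun v hv h => by
    by_contra hvp
    exact (hlt' v hv hvp).ne (h.trans hM)
  have hex : ∃ v ∈ Icc (0 : ℝ) 1, U R θ v = M R θ := ⟨p, ⟨hp0.le, hp1.le⟩, hM.symm⟩
  have hv : vInt R θ = p :=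
    huniq _ (Function.invFunOn_mem hex) (Function.invFunOn_eq hex)
  rw [hv]
  exact ⟨hp0, hp1, hpx ▸ hx, hM, hM ▸ hgr, huniq⟩

section BelowThreshold

variable {R θ : ℝ} (hR : 0 < R) (hθ : 0 < θ) (hlt : θ < thetaC R)
include hR hθ hlt

theorem vInt_pos : 0 < vInt R θ := (vInt_spec hR hθ hlt).1

theorem vInt_lt_one : vInt R θ < 1 := (vInt_spec hR hθ hlt).2.1

theorem M_eq : M R θ = U R θ (vInt R θ) := (vInt_spec hR hθ hlt).2.2.2.1

theorem M_pos : 0 < M R θ := M_eq hR hθ hlt ▸ U_pos (vInt_pos hR hθ hlt)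

theorem U_strictMonoOn_vInt : StrictMonoOn (U R θ) (Icc 0 (vInt R θ)) :=
  U_strictMonoOn hR hθ (vInt_pos hR hθ hlt) (vInt_spec hR hθ hlt).2.2.1.le

theorem U_strictAntiOn_vInt : StrictAntiOn (U R θ) (Ici (vInt R θ)) :=
  U_strictAntiOn hR hθ (vInt_pos hR hθ hlt) (vInt_spec hR hθ hlt).2.2.1.ge

theorem U_le_M {v : ℝ} (hv : 0 ≤ v) : U R θ v ≤ M R θ := by
  rw [M_eq hR hθ hlt]
  rcases le_total v (vInt R θ) with h | h
  · exact (U_strictMonoOn_vInt hR hθ hlt).monotoneOn ⟨hv, h⟩ ⟨hv.trans h, le_rfl⟩ h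
  · exact (U_strictAntiOn_vInt hR hθ hlt).antitoneOn self_mem_Ici h h

theorem U_one_lt_M : U R θ 1 < M R θ := by
  rw [M_eq hR hθ hlt]
  exact U_strictAntiOn_vInt hR hθ hlt self_mem_Ici (vInt_lt_one hR hθ hlt).le
    (vInt_lt_one hR hθ hlt)

theorem hasDerivAt_U_vInt : HasDerivAt (U R θ) 0 (vInt R θ) := by
  have h := hasDerivAt_U θ hR (vInt_pos hR hθ hlt)
  rw [(vInt_spec hR hθ hlt).2.2.1] at h
  simpa using h

theorem slopeU_pos {v : ℝ} (hv : vInt R θ < v) :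
    0 < slopeU (coef R θ) (R * Real.log 2 / v) := by
  have ha := mul_log_two_pos hR
  have hp := vInt_pos hR hθ hlt
  rw [← (vInt_spec hR hθ hlt).2.2.1]
  exact slopeU_strictAntiOn (coef_pos hR hθ) (div_pos ha (hp.trans hv)) (div_pos ha hp)
    (div_lt_div_of_pos_left ha hp hv)

theorem existsUnique_right {C : ℝ} (hC : C ∈ Icc (U R θ 1) (M R θ)) :
    ∃! v, v ∈ Icc (vInt R θ) 1 ∧ U R θ v = C := by
  have hp := vInt_pos hR hθ hlt
  have hc : ContinuousOn (U R θ) (Icc (vInt R θ) 1) :=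
    (continuousOn_U hR hθ).mono fun v hv => hp.le.trans hv.1
  obtain ⟨v, hv, hvC⟩ := intermediate_value_Icc' (vInt_lt_one hR hθ hlt).le hc
    ⟨hC.1, hC.2.trans (M_eq hR hθ hlt).le⟩
  exact ⟨v, ⟨hv, hvC⟩, fun w hw =>
    (U_strictAntiOn_vInt hR hθ hlt).injOn hw.1.1 hv.1 (hw.2.trans hvC.symm)⟩

theorem existsUnique_left {C : ℝ} (hC : C ∈ Icc 0 (M R θ)) :
    ∃! v, v ∈ Icc 0 (vInt R θ) ∧ U R θ v = C := by
  have hp := vInt_pos hR hθ hlt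
  have hc : ContinuousOn (U R θ) (Icc 0 (vInt R θ)) :=
    (continuousOn_U hR hθ).mono fun v hv => hv.1
  obtain ⟨v, hv, hvC⟩ := intermediate_value_Icc hp.le hc
    ⟨(U_zero R θ).le.trans hC.1, hC.2.trans (M_eq hR hθ hlt).le⟩
  exact ⟨v, ⟨hv, hvC⟩, fun w hw =>
    (U_strictMonoOn_vInt hR hθ hlt).injOn hw.1 hv (hw.2.trans hvC.symm)⟩

theorem Vplus_spec {C : ℝ} (hC : C ∈ Icc (U R θ 1) (M R θ)) :
    Vplus R θ C ∈ Icc (vInt R θ) 1 ∧ U R θ (Vplus R θ C) = C := by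
  have hex : ∃ v ∈ Icc (vInt R θ) 1, U R θ v = C := (existsUnique_right hR hθ hlt hC).exists
  exact ⟨Function.invFunOn_mem hex, Function.invFunOn_eq hex⟩

theorem Vminus_spec {C : ℝ} (hC : C ∈ Icc (U R θ 1) (M R θ)) :
    Vminus R θ C ∈ Icc 0 (vInt R θ) ∧ U R θ (Vminus R θ C) = C := by
  have hex : ∃ v ∈ Icc 0 (vInt R θ), U R θ v = C :=
    (existsUnique_left hR hθ hlt ⟨(U_pos one_pos).le.trans hC.1, hC.2⟩).exists
  exact ⟨Function.invFunOn_mem hex, Function.invFunOn_eq hex⟩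

theorem Vplus_U {v : ℝ} (hv : v ∈ Icc (vInt R θ) 1) : Vplus R θ (U R θ v) = v := by
  have h : ∃ w ∈ Icc (vInt R θ) 1, U R θ w = U R θ v := ⟨v, hv, rfl⟩
  exact (U_strictAntiOn_vInt hR hθ hlt).injOn (Function.invFunOn_mem h).1 hv.1
    (Function.invFunOn_eq h)

theorem Vminus_U {v : ℝ} (hv : v ∈ Icc 0 (vInt R θ)) : Vminus R θ (U R θ v) = v := by
  have h : ∃ w ∈ Icc 0 (vInt R θ), U R θ w = U R θ v := ⟨v, hv, rfl⟩
  exact (U_strictMonoOn_vInt hR hθ hlt).injOn (Function.invFunOn_mem h) hv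
    (Function.invFunOn_eq h)

theorem Vplus_strictAntiOn : StrictAntiOn (Vplus R θ) (Icc (U R θ 1) (M R θ)) := by
  intro C hC C' hC' h
  obtain ⟨h1, h2⟩ := Vplus_spec hR hθ hlt hC
  obtain ⟨h3, h4⟩ := Vplus_spec hR hθ hlt hC'
  exact ((U_strictAntiOn_vInt hR hθ hlt).lt_iff_gt h1.1 h3.1).1 (by rwa [h2, h4])

/-- An extension of `V⁺` to arguments below `𝒰(1)`. -/
noncomputable def VplusExt (R θ : ℝ) : ℝ → ℝ :=
  Function.invFunOn (U R θ) (Ici (vInt R θ))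

theorem VplusExt_eq {C : ℝ} (hC : C ∈ Icc (U R θ 1) (M R θ)) : VplusExt R θ C = Vplus R θ C := by
  obtain ⟨h1, h2⟩ := Vplus_spec hR hθ hlt hC
  have h : ∃ w ∈ Ici (vInt R θ), U R θ w = C := ⟨_, h1.1, h2⟩
  exact (U_strictAntiOn_vInt hR hθ hlt).injOn (Function.invFunOn_mem h) h1.1
    ((Function.invFunOn_eq h).trans h2.symm)

omit hR hθ hlt in
-- The inverse function theorem supplies an analytic local inverse, and injectivity on the
-- neighbourhood `s` forces `invFunOn` to agree with it near `f a`.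
theorem _root_.AnalyticAt.analyticAt_invFunOn {f : ℝ → ℝ} {a f' : ℝ} {s : Set ℝ}
    (hf : AnalyticAt ℝ f a) (hf' : HasDerivAt f f' a) (h0 : f' ≠ 0) (hs : s ∈ 𝓝 a)
    (hinj : InjOn f s) : AnalyticAt ℝ (Function.invFunOn f s) (f a) := by
  -- Here `⊤` is the analytic smoothness exponent ω, not merely C^∞.
  have hcd : ContDiffAt ℝ ⊤ f a := hf.contDiffAt
  have hfd : HasFDerivAt f
      (ContinuousLinearEquiv.unitsEquivAut ℝ (Units.mk0 f' h0) : ℝ →L[ℝ] ℝ) a := by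
    convert! hf'.hasFDerivAt
  have hg : ContDiffAt ℝ ⊤ (hcd.localInverse hfd (by simp)) (f a) := hcd.to_localInverse hfd _
  have hga := hcd.localInverse_apply_image hfd (by simp)
  have hstr := hcd.hasStrictFDerivAt' hfd (by simp)
  refine hg.analyticAt.congr ?_
  have hmem := hg.continuousAt.preimage_mem_nhds (t := s) (by rwa [hga])
  filter_upwards [hstr.eventually_right_inverse, hmem] with y hy hys
  have h : ∃ w ∈ s, f w = y := ⟨_, hys, hy⟩
  exact hinj hys (Function.invFunOn_mem h) (hy.trans (Function.invFunOn_eq h).symm)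

/-- The extension makes C = 𝒰(1) an interior point of the domain. C = M is excluded because 𝒰'
vanishes at the peak. -/
theorem analyticAt_VplusExt {C : ℝ} (hC : C ∈ Ico (U R θ 1) (M R θ)) :
    AnalyticAt ℝ (VplusExt R θ) C := by
  obtain ⟨h1, h2⟩ := Vplus_spec hR hθ hlt ⟨hC.1, hC.2.le⟩
  have hv : vInt R θ < Vplus R θ C := by
    refine h1.1.lt_of_ne fun h => hC.2.ne ?_
    rw [M_eq hR hθ hlt, ← h2, ← h]
  have hv0 := (vInt_pos hR hθ hlt).trans hv
  have := (analyticAt_U R θ hv0.ne').analyticAt_invFunOn (hasDerivAt_U θ hR hv0)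
    (neg_ne_zero.2 (mul_pos (mul_pos (U_pos hv0) (slopeU_pos hR hθ hlt hv))
      (div_pos (mul_log_two_pos hR) (pow_pos hv0 2))).ne')
    (Ici_mem_nhds hv) (U_strictAntiOn_vInt hR hθ hlt).injOn
  rwa [h2] at this

end BelowThreshold

/-! ### The sums `S⁺` and `S⁻` -/

/-- Expresses the arguments of all blocks through that of block `k`, so that the share of block `k`
can serve as the only parameter. -/
theorem Cfun_eq_div_mul {K : ℕ} (R θ : ℝ) {d : Fin K → ℝ} (hdpos : ∀ i, 0 < d i) (i k : Fin K)
    (lam : ℝ) : Cfun R θ d i lam = d k / d i * Cfun R θ d k lam := by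
  have h1 := (hdpos i).ne'
  have h2 := (hdpos k).ne'
  unfold Cfun
  rw [div_mul_div_comm, show d i * (θ * d k * R * Real.log 2) = d k * (θ * d i * R * Real.log 2) by
    ring, mul_div_mul_left _ _ h2]

theorem Cfun_eq_div {K : ℕ} (R θ : ℝ) (d : Fin K → ℝ) (i : Fin K) (lam : ℝ) :
    Cfun R θ d i lam = lam / (rate R θ * d i) := by
  rw [Cfun, rate, coef]
  by_cases hs : (2 : ℝ) ^ R - 1 = 0
  · simp [hs]
  · rw [div_mul_eq_mul_div, div_mul_eq_mul_div, div_div_eq_mul_div]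
    congr 1; ring

theorem lamUpp_eq {K : ℕ} (R θ : ℝ) (d : Fin K → ℝ) (k : Fin K) :
    lamUpp R θ d k = M R θ * (rate R θ * d k) := by
  rw [lamUpp, rate, coef]; ring

theorem sum_Iic_eq_sum {K : ℕ} {k : Fin K} {v : Fin K → ℝ} (h : ∀ i, k < i → v i = 0) :
    ∑ i ∈ Finset.Iic k, v i = ∑ i, v i :=
  Finset.sum_subset (Finset.subset_univ _) fun i _ hi => h i (by simpa using hi)

theorem sum_candPlus {K : ℕ} (R θ : ℝ) (d : Fin K → ℝ) (k : Fin K) (lam : ℝ) :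
    ∑ i, candPlus R θ d k lam i = Splus R θ d k lam := by
  rw [← sum_Iic_eq_sum (k := k) (v := candPlus R θ d k lam) fun i hi => if_neg hi.not_ge]
  exact Finset.sum_congr rfl fun i hi => if_pos (Finset.mem_Iic.1 hi)

theorem sum_candMinus {K : ℕ} (R θ : ℝ) (d : Fin K → ℝ) (k : Fin K) (lam : ℝ) :
    ∑ i, candMinus R θ d k lam i = Sminus R θ d k lam := by
  rw [← sum_Iic_eq_sum (k := k) fun i hi => by simp [candMinus, hi.not_gt, hi.ne'], Sminus,
    ← Finset.Iio_insert, Finset.sum_insert (by simp)]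
  congr 1
  · simp [candMinus]
  · exact Finset.sum_congr rfl fun i hi => if_pos (Finset.mem_Iio.1 hi)

section BelowThreshold

variable {K : ℕ} [NeZero K] {R θ : ℝ} (hR : 0 < R) (hθ : 0 < θ) (hlt : θ < thetaC R)
  {d : Fin K → ℝ} (hd : StrictAnti d) (hdpos : ∀ i, 0 < d i)

omit [NeZero K] in
include hR hθ hdpos in
theorem rate_mul_pos (i : Fin K) : 0 < rate R θ * d i := mul_pos (rate_pos hR hθ) (hdpos i)

include hR in
theorem lamLow_eq : lamLow R θ d = U R θ 1 * (rate R θ * d 0) := by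
  rw [lamLow, U_one R θ hR, rate, coef]; ring

omit [NeZero K] in
include hR hθ hdpos in
theorem Cfun_strictMono (i : Fin K) : StrictMono (Cfun R θ d i) := fun x y h => by
  rw [Cfun_eq_div, Cfun_eq_div]
  exact div_lt_div_of_pos_right h (rate_mul_pos hR hθ hdpos i)

omit [NeZero K] in
include hR hθ hdpos in
theorem Cfun_mul_U {k : Fin K} (w : ℝ) : Cfun R θ d k (U R θ w * (rate R θ * d k)) = U R θ w := by
  rw [Cfun_eq_div, mul_div_assoc, div_self (rate_mul_pos hR hθ hdpos k).ne', mul_one]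

include hR hθ hd hdpos

/-- λ_low is calibrated to the largest weight `d 0`, and λ_upp to the smallest weight `d k` among
the blocks up to `k`. -/
theorem Cfun_mem {i k : Fin K} (hik : i ≤ k) {lam : ℝ} (h : lam ∈ lamRange R θ d k) :
    Cfun R θ d i lam ∈ Icc (U R θ 1) (M R θ) := by
  have hi := rate_mul_pos hR hθ hdpos i
  have hr := rate_pos hR hθ
  obtain ⟨h1, h2⟩ := h
  rw [lamLow_eq hR] at h1
  rw [lamUpp_eq] at h2
  have hU : 0 < U R θ 1 := U_pos one_pos
  -- Positivity of M is read off from 0 < λ_low ≤ λ_upp, without the threshold condition.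
  have hM : 0 < M R θ := by
    have h3 := (mul_pos hU (rate_mul_pos hR hθ hdpos 0)).trans_le (h1.trans h2)
    exact pos_of_mul_pos_left h3 (rate_mul_pos hR hθ hdpos k).le
  rw [Cfun_eq_div]
  constructor
  · rw [le_div_iff₀ hi]
    exact (mul_le_mul_of_nonneg_left (mul_le_mul_of_nonneg_left
      (hd.antitone (Fin.zero_le i)) hr.le) hU.le).trans h1
  · rw [div_le_iff₀ hi]
    exact h2.trans (mul_le_mul_of_nonneg_left (mul_le_mul_of_nonneg_left
      (hd.antitone hik) hr.le) hM.le)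

include hlt

omit hdpos in
-- The condition defining ℓ_ORA is λ_low ≤ λ_upp(i) rearranged; since `d` decreases, the admissible
-- indices form an initial segment.
theorem lamLow_le_lamUpp_iff (k : Fin K) :
    lamLow R θ d ≤ lamUpp R θ d k ↔ (k : ℕ) + 1 ≤ ellORA R θ d := by
  have hM := M_pos hR hθ hlt
  have hU : (0 : ℝ) < U R θ 1 := U_pos one_pos
  have key : ∀ i : Fin K, (2 : ℝ) ^ R * Real.exp (-θ) / M R θ * d 0 ≤ d i ↔
      lamLow R θ d ≤ lamUpp R θ d i := fun i => by
    rw [lamLow_eq hR, lamUpp_eq, ← U_one R θ hR, div_mul_eq_mul_div, div_le_iff₀ hM,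
      mul_left_comm, mul_left_comm (M R θ), mul_le_mul_iff_right₀ (rate_pos hR hθ),
      mul_comm (d i)]
  constructor
  · intro h
    exact Finset.le_sup (f := fun i : Fin K => (i : ℕ) + 1) (by simpa using (key k).2 h)
  · intro h
    obtain ⟨i, hi, hle⟩ := (Finset.le_sup_iff (Nat.succ_pos _)).1 h
    have hi' := (key i).1 (by simpa using hi)
    refine hi'.trans ?_
    rw [lamUpp_eq, lamUpp_eq]
    have hki : k ≤ i := by
      rw [Fin.le_def]; omega
    exact mul_le_mul_of_nonneg_left (mul_le_mul_of_nonneg_left (hd.antitone hki)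
      (rate_pos hR hθ).le) hM.le

/-- The sum of the resources of the blocks up to `k`, as a function of the share of block `k`. -/
noncomputable def branchSum (R θ : ℝ) (d : Fin K → ℝ) (k : Fin K) (w : ℝ) : ℝ :=
  w + ∑ i ∈ Finset.Iio k, VplusExt R θ (d k / d i * U R θ w)

/-- Both sums are values of one function of the share w. Unlike V⁺ and V⁻ as functions of λ, it
stays smooth at the peak. -/
theorem Splus_eq_branchSum {k : Fin K} {lam : ℝ} (h : lam ∈ lamRange R θ d k) :
    Splus R θ d k lam = branchSum R θ d k (Vplus R θ (Cfun R θ d k lam)) := by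
  rw [Splus, branchSum, ← Finset.Iio_insert, Finset.sum_insert (by simp)]
  congr 1
  refine Finset.sum_congr rfl fun i hi => ?_
  have hik : i ≤ k := (Finset.mem_Iio.1 hi).le
  rw [(Vplus_spec hR hθ hlt (Cfun_mem hR hθ hd hdpos le_rfl h)).2,
    ← Cfun_eq_div_mul R θ hdpos, VplusExt_eq hR hθ hlt (Cfun_mem hR hθ hd hdpos hik h)]

theorem Sminus_eq_branchSum {k : Fin K} {lam : ℝ} (h : lam ∈ lamRange R θ d k) :
    Sminus R θ d k lam = branchSum R θ d k (Vminus R θ (Cfun R θ d k lam)) := by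
  rw [Sminus, branchSum]
  congr 1
  refine Finset.sum_congr rfl fun i hi => ?_
  have hik : i ≤ k := (Finset.mem_Iio.1 hi).le
  rw [(Vminus_spec hR hθ hlt (Cfun_mem hR hθ hd hdpos le_rfl h)).2,
    ← Cfun_eq_div_mul R θ hdpos, VplusExt_eq hR hθ hlt (Cfun_mem hR hθ hd hdpos hik h)]

/-- The strict inequality d_k < d_i keeps the argument below M even when w is the peak, so
`VplusExt` is analytic there. -/
theorem ratio_mul_U_mem {i k : Fin K} (hik : i < k) {w : ℝ} (hw : 0 < w)
    (hU : Cfun R θ d k (lamLow R θ d) ≤ U R θ w) :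
    d k / d i * U R θ w ∈ Ico (U R θ 1) (M R θ) := by
  have hr : 0 < d k / d i := div_pos (hdpos k) (hdpos i)
  refine ⟨?_, ?_⟩
  · refine le_trans ?_ (mul_le_mul_of_nonneg_left hU hr.le)
    rw [← Cfun_eq_div_mul R θ hdpos, Cfun_eq_div, lamLow_eq hR,
      le_div_iff₀ (rate_mul_pos hR hθ hdpos i)]
    exact mul_le_mul_of_nonneg_left (mul_le_mul_of_nonneg_left
      (hd.antitone (Fin.zero_le i)) (rate_pos hR hθ).le) (U_pos one_pos).le
  · exact (mul_lt_of_lt_one_left (U_pos hw) ((div_lt_one (hdpos i)).2 (hd hik))).trans_le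
      (U_le_M hR hθ hlt hw.le)

theorem analyticAt_branchSum {k : Fin K} {w : ℝ} (hw : 0 < w)
    (hU : Cfun R θ d k (lamLow R θ d) ≤ U R θ w) : AnalyticAt ℝ (branchSum R θ d k) w := by
  refine analyticAt_id.add (Finset.analyticAt_fun_sum _ fun i hi => ?_)
  exact (analyticAt_VplusExt hR hθ hlt (ratio_mul_U_mem hR hθ hlt hd hdpos
    (Finset.mem_Iio.1 hi) hw hU)).fun_comp (f := fun w => d k / d i * U R θ w)
    (analyticAt_const.mul (analyticAt_U R θ hw.ne'))

/-- At the peak 𝒰' = 0, so the other blocks are stationary and only the term w contributes. -/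
theorem hasDerivAt_branchSum {k : Fin K}
    (hU : Cfun R θ d k (lamLow R θ d) ≤ M R θ) :
    HasDerivAt (branchSum R θ d k) 1 (vInt R θ) := by
  have hp := vInt_pos hR hθ hlt
  rw [M_eq hR hθ hlt] at hU
  have h : HasDerivAt (fun w => ∑ i ∈ Finset.Iio k, VplusExt R θ (d k / d i * U R θ w))
      (∑ i ∈ Finset.Iio k, deriv (VplusExt R θ) (d k / d i * U R θ (vInt R θ)) * (d k / d i * 0))
      (vInt R θ) := by
    refine HasDerivAt.fun_sum fun i hi => ?_
    exact (analyticAt_VplusExt hR hθ hlt (ratio_mul_U_mem hR hθ hlt hd hdpos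
      (Finset.mem_Iio.1 hi) hp hU)).differentiableAt.hasDerivAt.comp (vInt R θ)
      ((hasDerivAt_U_vInt hR hθ hlt).const_mul (d k / d i))
  simpa [branchSum] using! (hasDerivAt_id (vInt R θ)).add h

theorem Splus_strictAntiOn (k : Fin K) :
    StrictAntiOn (Splus R θ d k) (lamRange R θ d k) := by
  intro x hx y hy hxy
  refine Finset.sum_lt_sum_of_nonempty ⟨k, by simp⟩ fun i hi => ?_
  have hik : i ≤ k := Finset.mem_Iic.1 hi
  exact Vplus_strictAntiOn hR hθ hlt (Cfun_mem hR hθ hd hdpos hik hx)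
    (Cfun_mem hR hθ hd hdpos hik hy) (Cfun_strictMono hR hθ hdpos i hxy)

/-- The intermediate value theorem is applied in w: the peak corresponds to λ_upp and W to λ_low. -/
theorem exists_Splus_eq_one {k : Fin K} (hk : lamLow R θ d ≤ lamUpp R θ d k)
    (h1 : 1 ≤ Splus R θ d k (lamLow R θ d)) (h2 : Splus R θ d k (lamUpp R θ d k) ≤ 1) :
    ∃ lam ∈ lamRange R θ d k, Splus R θ d k lam = 1 := by
  have hlow : lamLow R θ d ∈ lamRange R θ d k := ⟨le_rfl, hk⟩
  have hupp : lamUpp R θ d k ∈ lamRange R θ d k := ⟨hk, le_rfl⟩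
  have hrk := rate_mul_pos hR hθ hdpos k
  have hp := vInt_pos hR hθ hlt
  obtain ⟨hw, hUw⟩ := Vplus_spec hR hθ hlt (Cfun_mem hR hθ hd hdpos le_rfl hlow)
  rw [Splus_eq_branchSum hR hθ hlt hd hdpos hlow] at h1
  rw [Splus_eq_branchSum hR hθ hlt hd hdpos hupp] at h2
  set W := Vplus R θ (Cfun R θ d k (lamLow R θ d)) with hW
  have hCupp : Vplus R θ (Cfun R θ d k (lamUpp R θ d k)) = vInt R θ := by
    rw [lamUpp_eq, M_eq hR hθ hlt, Cfun_mul_U hR hθ hdpos,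
      Vplus_U hR hθ hlt ⟨le_rfl, (vInt_lt_one hR hθ hlt).le⟩]
  rw [hCupp] at h2
  have hUge : ∀ w ∈ Icc (vInt R θ) W, Cfun R θ d k (lamLow R θ d) ≤ U R θ w := fun w hw' => by
    rw [← hUw]
    exact (U_strictAntiOn_vInt hR hθ hlt).antitoneOn hw'.1 hw.1 hw'.2
  have hcont : ContinuousOn (branchSum R θ d k) (Icc (vInt R θ) W) := fun w hw' =>
    (analyticAt_branchSum hR hθ hlt hd hdpos (hp.trans_le hw'.1)
      (hUge w hw')).continuousAt.continuousWithinAt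
  obtain ⟨w, hw', hw1⟩ := intermediate_value_Icc hw.1 hcont ⟨h2, h1⟩
  have hmem : U R θ w * (rate R θ * d k) ∈ lamRange R θ d k := by
    refine ⟨?_, ?_⟩
    · rw [← (Cfun_strictMono hR hθ hdpos k).le_iff_le, Cfun_mul_U hR hθ hdpos]
      exact hUge w hw'
    · rw [lamUpp_eq]
      exact mul_le_mul_of_nonneg_right (U_le_M hR hθ hlt (hp.le.trans hw'.1)) hrk.le
  refine ⟨_, hmem, ?_⟩
  rw [Splus_eq_branchSum hR hθ hlt hd hdpos hmem, Cfun_mul_U hR hθ hdpos,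
    Vplus_U hR hθ hlt ⟨hw'.1, hw'.2.trans hw.2⟩, hw1]

/-- Infinitely many roots would accumulate in the compact interval, and the identity theorem would
make the function constantly 1, against its derivative 1 at the right endpoint. -/
theorem branchSum_finite {k : Fin K} {W : ℝ} (hW0 : 0 < W)
    (hUW : Cfun R θ d k (lamLow R θ d) ≤ U R θ W) :
    {w ∈ Icc W (vInt R θ) | branchSum R θ d k w = 1}.Finite := by
  have hp := vInt_pos hR hθ hlt
  rcases le_or_gt (vInt R θ) W with hWp | hWp
  · exact (subsingleton_Icc_of_ge hWp).finite.subset (sep_subset _ _)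
  have hUge : ∀ w ∈ Icc W (vInt R θ), Cfun R θ d k (lamLow R θ d) ≤ U R θ w := fun w hw =>
    hUW.trans ((U_strictMonoOn_vInt hR hθ hlt).monotoneOn ⟨hW0.le, hWp.le⟩
      ⟨hW0.le.trans hw.1, hw.2⟩ hw.1)
  have han : AnalyticOnNhd ℝ (branchSum R θ d k) (Icc W (vInt R θ)) := fun w hw =>
    analyticAt_branchSum hR hθ hlt hd hdpos (hW0.trans_le hw.1) (hUge w hw)
  by_contra hinf
  obtain ⟨z, hz, hacc⟩ := Set.Infinite.exists_accPt_of_subset_isCompact hinf isCompact_Icc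
    (sep_subset _ _)
  have hfreq : ∃ᶠ w in 𝓝[≠] z, branchSum R θ d k w = (fun _ => (1 : ℝ)) w :=
    (accPt_iff_frequently_nhdsNE.1 hacc).mono fun w hw => hw.2
  have heq := han.eqOn_of_preconnected_of_frequently_eq (analyticOnNhd_const)
    isPreconnected_Icc hz hfreq
  have hpmem : vInt R θ ∈ Icc W (vInt R θ) := ⟨hWp.le, le_rfl⟩
  have hder := (hasDerivAt_branchSum hR hθ hlt hd hdpos (k := k)
    (M_eq hR hθ hlt ▸ hUge _ hpmem)).hasDerivWithinAt (s := Icc W (vInt R θ))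
  have hder0 : HasDerivWithinAt (branchSum R θ d k) 0 (Icc W (vInt R θ)) (vInt R θ) :=
    (hasDerivWithinAt_const (vInt R θ) _ (1 : ℝ)).congr heq (heq hpmem)
  exact one_ne_zero ((uniqueDiffOn_Icc hWp _ hpmem).eq_deriv _ hder hder0)

theorem Sminus_roots_finite (k : Fin K) :
    {lam | lam ∈ lamRange R θ d k ∧ Sminus R θ d k lam = 1}.Finite := by
  by_cases hk : lamLow R θ d ≤ lamUpp R θ d k
  swap
  · refine Set.finite_empty.subset fun lam h => hk (h.1.1.trans h.1.2)
  have hlow : lamLow R θ d ∈ lamRange R θ d k := ⟨le_rfl, hk⟩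
  have hClow := Cfun_mem hR hθ hd hdpos le_rfl hlow
  obtain ⟨hw, hUw⟩ := Vminus_spec hR hθ hlt hClow
  -- At the left end 𝒰 ≥ 𝒰(1) > 0, which keeps w away from 0, where analyticity is not available.
  have hW0 : 0 < Vminus R θ (Cfun R θ d k (lamLow R θ d)) := by
    refine hw.1.lt_of_ne fun h => ?_
    rw [← h, U_zero] at hUw
    exact (U_pos one_pos).not_ge (hClow.1.trans hUw.ge)
  refine ((branchSum_finite hR hθ hlt hd hdpos hW0 hUw.ge).image
    fun w => U R θ w * (rate R θ * d k)).subset ?_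
  rintro lam ⟨hmem, hS⟩
  have hC := Cfun_mem hR hθ hd hdpos le_rfl hmem
  obtain ⟨hv, hUv⟩ := Vminus_spec hR hθ hlt hC
  rw [Sminus_eq_branchSum hR hθ hlt hd hdpos hmem] at hS
  refine ⟨_, ⟨⟨?_, hv.2⟩, hS⟩, ?_⟩
  · rw [← (U_strictMonoOn_vInt hR hθ hlt).le_iff_le hw hv, hUw, hUv]
    exact (Cfun_strictMono hR hθ hdpos k).monotone hmem.1
  · show U R θ _ * _ = _
    rw [hUv, Cfun_eq_div, div_mul_cancel₀ _ (rate_mul_pos hR hθ hdpos k).ne']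

/-- Shows that the test S⁺(λ_low) ≥ 1 loses no root of S⁻ = 1. -/
theorem Sminus_le_Splus {k : Fin K} {lam : ℝ} (h : lam ∈ lamRange R θ d k) :
    Sminus R θ d k lam ≤ Splus R θ d k lam := by
  have hC := Cfun_mem hR hθ hd hdpos le_rfl h
  rw [Splus, Sminus, ← Finset.Iio_insert, Finset.sum_insert (by simp)]
  exact add_le_add_left ((Vminus_spec hR hθ hlt hC).1.2.trans (Vplus_spec hR hθ hlt hC).1.1) _

theorem candPlus_mem {k : Fin K} {lam : ℝ} (h : lam ∈ lamRange R θ d k)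
    (h1 : Splus R θ d k lam = 1) : candPlus R θ d k lam ∈ stdSimplex ℝ (Fin K) := by
  refine ⟨fun i => ?_, ?_⟩
  · unfold candPlus
    split_ifs with hik
    · exact (vInt_pos hR hθ hlt).le.trans
        (Vplus_spec hR hθ hlt (Cfun_mem hR hθ hd hdpos hik h)).1.1
    · exact le_rfl
  · rw [sum_candPlus, h1]

theorem candMinus_mem {k : Fin K} {lam : ℝ} (h : lam ∈ lamRange R θ d k)
    (h1 : Sminus R θ d k lam = 1) : candMinus R θ d k lam ∈ stdSimplex ℝ (Fin K) := by
  refine ⟨fun i => ?_, ?_⟩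
  · unfold candMinus
    split_ifs with hik hik'
    · exact (vInt_pos hR hθ hlt).le.trans
        (Vplus_spec hR hθ hlt (Cfun_mem hR hθ hd hdpos hik.le h)).1.1
    · exact (Vminus_spec hR hθ hlt (Cfun_mem hR hθ hd hdpos le_rfl h)).1.1
    · exact le_rfl
  · rw [sum_candMinus, h1]

end BelowThreshold

/-! ### Maximizers -/

section Maximizers

theorem t_nonneg (R θ v : ℝ) : 0 ≤ t R θ v := by
  by_cases h : v = 0
  · rw [h, t_zero]
  · exact (t_pos h).le

theorem t_strictMonoOn {R θ : ℝ} (hR : 0 < R) (hθ : 0 < θ) : StrictMonoOn (t R θ) (Ici 0) := by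
  refine strictMonoOn_of_deriv_pos (convex_Ici 0) (continuousOn_t hR hθ) fun v hv => ?_
  rw [interior_Ici] at hv
  rw [(hasDerivAt_t R θ (ne_of_gt hv)).deriv]
  exact mul_pos (rate_pos hR hθ) (U_pos hv)

/-- The derivative of `t` is proportional to `U`. The cases used are p = v_int below the threshold
and p = 1 at or above it. -/
theorem t_strictConvexOn {R θ p : ℝ} (hR : 0 < R) (hθ : 0 < θ) (hp : 0 < p)
    (h : slopeU (coef R θ) (R * Real.log 2 / p) ≤ 0) : StrictConvexOn ℝ (Icc 0 p) (t R θ) := by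
  refine StrictMonoOn.strictConvexOn_of_deriv (convex_Icc 0 p)
    ((continuousOn_t hR hθ).mono fun v hv => hv.1) ?_
  rw [interior_Icc]
  intro v hv w hw hvw
  rw [(hasDerivAt_t R θ hv.1.ne').deriv, (hasDerivAt_t R θ hw.1.ne').deriv]
  exact mul_lt_mul_of_pos_left
    (U_strictMonoOn hR hθ hp h (Ioo_subset_Icc_self hv) (Ioo_subset_Icc_self hw) hvw)
    (rate_pos hR hθ)

variable {K : ℕ} {R θ : ℝ} {d v : Fin K → ℝ}

theorem sum_update_update {i j : Fin K} (hij : i ≠ j) (F : Fin K → ℝ → ℝ) (v : Fin K → ℝ)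
    (x y : ℝ) : ∑ l, F l (Function.update (Function.update v i x) j y l) - ∑ l, F l (v l) =
      (F i x - F i (v i)) + (F j y - F j (v j)) := by
  rw [← Finset.sum_sub_distrib, Fintype.sum_eq_add i j hij]
  · simp [hij]
  · rintro l ⟨hi, hj⟩
    simp [hi, hj]

/-- Redistribution between two blocks preserves feasibility; order, convexity and marginal
conditions all follow from this comparison. -/
theorem IsMaximizer.pair_le (hv : IsMaximizer R θ d v) {i j : Fin K} (hij : i ≠ j) {x y : ℝ}
    (hx : 0 ≤ x) (hy : 0 ≤ y) (hxy : x + y = v i + v j) :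
    t R θ x * d i + t R θ y * d j ≤ t R θ (v i) * d i + t R θ (v j) * d j := by
  have hsum := sum_update_update hij (fun _ z => z) v x y
  have hT := sum_update_update hij (fun l z => t R θ z * d l) v x y
  have hmem : Function.update (Function.update v i x) j y ∈ stdSimplex ℝ (Fin K) := by
    refine ⟨fun l => ?_, ?_⟩
    · by_cases hj : l = j
      · simpa [hj] using hy
      · by_cases hi : l = i
        · subst hi; simpa [hj] using hx
        · simpa [hi, hj] using hv.1.1 l
    · have h1 := hv.1.2
      linarith
  have h := hv.2 hmem
  simp only [mem_ofPred_eq, T] at h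
  linarith

theorem IsMaximizer.le_one (hv : IsMaximizer R θ d v) (i : Fin K) : v i ≤ 1 :=
  hv.1.2 ▸ Finset.single_le_sum (fun j _ => hv.1.1 j) (Finset.mem_univ i)

theorem IsMaximizer.add_le_one (hv : IsMaximizer R θ d v) {i j : Fin K} (hij : i ≠ j) :
    v i + v j ≤ 1 := by
  rw [← hv.1.2, ← Finset.sum_pair hij]
  exact Finset.sum_le_sum_of_subset_of_nonneg (Finset.subset_univ _) fun l _ _ => hv.1.1 l

theorem _root_.StrictConvexOn.two_mul_lt {f : ℝ → ℝ} {s : Set ℝ} (hf : StrictConvexOn ℝ s f)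
    {x δ : ℝ} (hδ : 0 < δ) (h1 : x - δ ∈ s) (h2 : x + δ ∈ s) :
    2 * f x < f (x - δ) + f (x + δ) := by
  have h := hf.2 h1 h2 (by linarith) (one_half_pos (α := ℝ)) one_half_pos (by norm_num)
  simp only [smul_eq_mul] at h
  rw [show 1 / 2 * (x - δ) + 1 / 2 * (x + δ) = x by ring] at h
  linarith

/-- By strict convexity the two opposite transfers of δ have an average value above the current one,
so one of them improves it. -/
theorem IsMaximizer.not_both_mem_convex (hv : IsMaximizer R θ d v) (hdpos : ∀ i, 0 < d i)
    {p : ℝ} (hconv : StrictConvexOn ℝ (Icc 0 p) (t R θ)) {i j : Fin K} (hij : i ≠ j)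
    (hi : v i ∈ Ioo 0 p) (hj : v j ∈ Ioo 0 p) : False := by
  obtain ⟨δ, hδ, hδ'⟩ : ∃ δ > 0, δ ≤ v i ∧ δ ≤ v j ∧ δ ≤ p - v i ∧ δ ≤ p - v j := by
    refine ⟨min (min (v i) (v j)) (min (p - v i) (p - v j)), ?_, ?_, ?_, ?_, ?_⟩
    · simp [hi.1, hi.2, hj.1, hj.2]
    all_goals simp
  obtain ⟨h1, h2, h3, h4⟩ := hδ'
  have hi' := hconv.two_mul_lt hδ (x := v i) ⟨by linarith, by linarith⟩ ⟨by linarith, by linarith⟩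
  have hj' := hconv.two_mul_lt hδ (x := v j) ⟨by linarith, by linarith⟩ ⟨by linarith, by linarith⟩
  have ha := hv.pair_le hij (x := v i - δ) (y := v j + δ) (by linarith) (by linarith) (by ring)
  have hb := hv.pair_le hij (x := v i + δ) (y := v j - δ) (by linarith) (by linarith) (by ring)
  have hi'' := mul_lt_mul_of_pos_right hi' (hdpos i)
  have hj'' := mul_lt_mul_of_pos_right hj' (hdpos j)
  linarith

/-- Swapping two entries in the wrong order would gain (t(v_j) - t(v_i))(d_i - d_j) > 0. -/
theorem IsMaximizer.antitone (hR : 0 < R) (hθ : 0 < θ) (hd : StrictAnti d)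
    (hv : IsMaximizer R θ d v) : Antitone v := by
  intro i j hij
  by_contra! h
  have hij' : i < j := hij.lt_of_ne fun e => by simp [e] at h
  have h1 := hv.pair_le hij'.ne (hv.1.1 j) (hv.1.1 i) (add_comm _ _)
  have h2 := t_strictMonoOn hR hθ (hv.1.1 i) (hv.1.1 j) h
  nlinarith [mul_pos (sub_pos.2 h2) (sub_pos.2 (hd hij'))]

/-- The marginal values of all the blocks in use agree. -/
theorem IsMaximizer.marginal_eq (hR : 0 < R) (hθ : 0 < θ) (hv : IsMaximizer R θ d v)
    {i j : Fin K} (hi : 0 < v i) (hj : 0 < v j) : U R θ (v i) * d i = U R θ (v j) * d j := by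
  by_cases hij : i = j
  · rw [hij]
  have h1 : HasDerivAt (fun s => t R θ (v i + s) * d i + t R θ (v j - s) * d j)
      (rate R θ * U R θ (v i) * d i + -(rate R θ * U R θ (v j)) * d j) 0 := by
    refine HasDerivAt.add (HasDerivAt.mul_const ?_ _) (HasDerivAt.mul_const ?_ _)
    · refine HasDerivAt.comp_const_add (v i) 0 ?_
      simpa using hasDerivAt_t R θ hi.ne'
    · refine HasDerivAt.comp_const_sub (v j) 0 ?_
      simpa using hasDerivAt_t R θ hj.ne'
  have hmax : IsLocalMax (fun s => t R θ (v i + s) * d i + t R θ (v j - s) * d j) 0 := by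
    filter_upwards [Ioo_mem_nhds (neg_lt_zero.2 hi) hj] with s hs
    simpa using hv.pair_le hij (x := v i + s) (y := v j - s) (by linarith [hs.1])
      (by linarith [hs.2]) (by ring)
  have h0 := hmax.hasDerivAt_eq_zero h1
  have h2 : rate R θ * (U R θ (v i) * d i - U R θ (v j) * d j) = 0 := by linarith
  exact sub_eq_zero.1 ((mul_eq_zero.1 h2).resolve_left (rate_pos hR hθ).ne')

variable [NeZero K]

theorem e1_mem : (e1 : Fin K → ℝ) ∈ stdSimplex ℝ (Fin K) := single_mem_stdSimplex ℝ 0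

theorem exists_isMaximizer (hR : 0 < R) (hθ : 0 < θ) (d : Fin K → ℝ) :
    ∃ v, IsMaximizer R θ d v := by
  have hcont : ContinuousOn (T R θ d) (stdSimplex ℝ (Fin K)) := by
    refine continuousOn_finsetSum _ fun i _ => ContinuousOn.mul ?_ continuousOn_const
    exact (continuousOn_t hR hθ).comp (continuous_apply i).continuousOn fun v hv => hv.1 i
  obtain ⟨v, hv, hmax⟩ := (isCompact_stdSimplex ℝ (Fin K)).exists_isMaxOn ⟨e1, e1_mem⟩ hcont
  exact ⟨v, hv, hmax⟩

theorem eq_e1_of_forall_eq_zero (hv : v ∈ stdSimplex ℝ (Fin K)) (h : ∀ i, i ≠ 0 → v i = 0) :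
    v = e1 := by
  have h0 : v 0 = 1 := by
    rw [← hv.2, Fintype.sum_eq_single 0 h]
  funext i
  by_cases hi : i = 0
  · rw [hi, h0]; simp [e1]
  · rw [h i hi]; simp [e1, hi]

theorem IsMaximizer.pos_zero (hR : 0 < R) (hθ : 0 < θ) (hd : StrictAnti d)
    (hv : IsMaximizer R θ d v) : 0 < v 0 := by
  refine (hv.1.1 0).lt_of_ne fun h => ?_
  have hz : ∀ i, v i = 0 := fun i =>
    le_antisymm (h ▸ hv.antitone hR hθ hd (Fin.zero_le i)) (hv.1.1 i)
  have := hv.1.2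
  simp [hz] at this

/-- Two positive shares have sum at most 1, so both would lie in (0, 1), where `t` is now strictly
convex. -/
theorem IsMaximizer.eq_e1_of_thetaC_le (hR : 0 < R) (hθ : 0 < θ) (hd : StrictAnti d)
    (hdpos : ∀ i, 0 < d i) (hc : thetaC R ≤ θ) (hv : IsMaximizer R θ d v) : v = e1 := by
  have hs : slopeU (coef R θ) (R * Real.log 2 / 1) ≤ 0 := by
    rw [div_one]; exact not_lt.1 fun h => hc.not_gt ((lt_thetaC_iff hR).2 h)
  refine eq_e1_of_forall_eq_zero hv.1 fun i hi => ?_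
  by_contra hvi
  have hi0 : 0 < v i := (hv.1.1 i).lt_of_ne' hvi
  have h00 := hv.pos_zero hR hθ hd
  have hadd := hv.add_le_one hi
  exact hv.not_both_mem_convex hdpos (t_strictConvexOn hR hθ one_pos hs) hi
    ⟨hi0, by linarith⟩ ⟨h00, by linarith⟩

/-- The form of every maximizer below the threshold. -/
theorem IsMaximizer.eq_e1_or_cand (hR : 0 < R) (hθ : 0 < θ) (hlt : θ < thetaC R)
    (hd : StrictAnti d) (hdpos : ∀ i, 0 < d i) (hv : IsMaximizer R θ d v) :
    v = e1 ∨ ∃ (k : Fin K) (lam : ℝ), 2 ≤ (k : ℕ) + 1 ∧ (k : ℕ) + 1 ≤ ellORA R θ d ∧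
      lam ∈ lamRange R θ d k ∧
      (v = candPlus R θ d k lam ∨ v = candMinus R θ d k lam) ∧ ∑ i ∈ Finset.Iic k, v i = 1 := by
  have h00 := hv.pos_zero hR hθ hd
  have hanti := hv.antitone hR hθ hd
  obtain ⟨k, hk, hkmax⟩ : ∃ k, 0 < v k ∧ ∀ i, k < i → v i = 0 := by
    obtain ⟨k, hk, hmax⟩ := Finset.exists_max_image
      (Finset.univ.filter fun i => 0 < v i) id ⟨0, by simpa using h00⟩
    refine ⟨k, by simpa using hk, fun i hi => ?_⟩
    by_contra hvi
    exact (hmax i (by simpa using (hv.1.1 i).lt_of_ne' hvi)).not_gt hi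
  by_cases hk0 : k = 0
  · exact Or.inl (eq_e1_of_forall_eq_zero hv.1 fun i hi =>
      hkmax i (hk0 ▸ Fin.pos_iff_ne_zero.2 hi))
  right
  have hk0' : 0 < k := Fin.pos_iff_ne_zero.2 hk0
  have hconv := t_strictConvexOn hR hθ (vInt_pos hR hθ hlt) (vInt_spec hR hθ hlt).2.2.1.le
  have hpos : ∀ i ≤ k, 0 < v i := fun i hi => hk.trans_le (hanti hi)
  -- If an earlier entry were left of the peak, the smaller positive entry `v k` would be too.
  have hge : ∀ i < k, vInt R θ ≤ v i := fun i hi => by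
    by_contra! h
    exact hv.not_both_mem_convex hdpos hconv hi.ne ⟨hpos i hi.le, h⟩
      ⟨hk, (hanti hi.le).trans_lt h⟩
  set lam := U R θ (v k) * (rate R θ * d k) with hlam
  have hlam_eq : ∀ i ≤ k, lam = U R θ (v i) * (rate R θ * d i) := fun i hi => by
    have := hv.marginal_eq hR hθ hk (hpos i hi)
    rw [hlam, mul_left_comm, this, mul_left_comm]
  have hmem : lam ∈ lamRange R θ d k := by
    refine ⟨?_, ?_⟩
    -- Block 0 precedes `k`, hence lies on the decreasing branch, and v_0 ≤ 1 gives 𝒰(v_0) ≥ 𝒰(1).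
    · rw [hlam_eq 0 hk0'.le, lamLow_eq hR]
      refine mul_le_mul_of_nonneg_right ?_ (rate_mul_pos hR hθ hdpos 0).le
      exact (U_strictAntiOn_vInt hR hθ hlt).antitoneOn (hge 0 hk0')
        (vInt_lt_one hR hθ hlt).le (hv.le_one 0)
    · rw [lamUpp_eq, hlam]
      exact mul_le_mul_of_nonneg_right (U_le_M hR hθ hlt hk.le) (rate_mul_pos hR hθ hdpos k).le
  have hC : ∀ i ≤ k, Cfun R θ d i lam = U R θ (v i) := fun i hi => by
    rw [hlam_eq i hi, Cfun_mul_U hR hθ hdpos]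
  have hplus : ∀ i < k, v i = Vplus R θ (Cfun R θ d i lam) := fun i hi => by
    rw [hC i hi.le, Vplus_U hR hθ hlt ⟨hge i hi, hv.le_one i⟩]
  refine ⟨k, lam, ?_, (lamLow_le_lamUpp_iff hR hθ hlt hd k).1 (hmem.1.trans hmem.2), hmem, ?_, ?_⟩
  · have : 0 < (k : ℕ) := hk0'
    omega
  · rcases le_total (vInt R θ) (v k) with h | h
    · left
      funext i
      unfold candPlus
      split_ifs with hik
      · rcases hik.eq_or_lt with rfl | hik
        · rw [hC _ le_rfl, Vplus_U hR hθ hlt ⟨h, hv.le_one _⟩]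
        · exact hplus i hik
      · exact hkmax i (not_le.1 hik)
    · right
      funext i
      unfold candMinus
      split_ifs with hik hik'
      · exact hplus i hik
      · rw [hik', hC _ le_rfl, Vminus_U hR hθ hlt ⟨hk.le, h⟩]
      · exact hkmax i ((not_lt.1 hik).lt_of_ne' hik')
  · rw [sum_Iic_eq_sum hkmax, hv.1.2]

end Maximizers

/-! ### Correctness of the algorithm -/

section Algorithm

variable {K : ℕ} [NeZero K] {R θ : ℝ} (hR : 0 < R) (hθ : 0 < θ) (hlt : θ < thetaC R)
  {d : Fin K → ℝ} (hd : StrictAnti d) (hdpos : ∀ i, 0 < d i)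

omit [NeZero K] in
theorem T_zero (R θ : ℝ) (d : Fin K → ℝ) : T R θ d 0 = 0 := by simp [T, t_zero]

include hdpos in
theorem T_e1_pos : 0 < T R θ d e1 := by
  refine Finset.sum_pos' (fun i _ => mul_nonneg (t_nonneg R θ _) (hdpos i).le)
    ⟨0, Finset.mem_univ _, mul_pos (t_pos ?_) (hdpos 0)⟩
  simp [e1]

include hR hθ hlt hd hdpos

theorem exists_plusPhase {k : Fin K} (hk : (k : ℕ) + 1 ≤ ellORA R θ d) :
    ∃ A, PlusPhase R θ d k A ∧ A.Finite := by
  have hk' := (lamLow_le_lamUpp_iff hR hθ hlt hd k).2 hk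
  by_cases h : 1 ≤ Splus R θ d k (lamLow R θ d) ∧ Splus R θ d k (lamUpp R θ d k) ≤ 1
  · obtain ⟨lam, hmem, h1⟩ := exists_Splus_eq_one hR hθ hlt hd hdpos hk' h.1 h.2
    refine ⟨{candPlus R θ d k lam}, ?_, finite_singleton _⟩
    rw [PlusPhase, if_pos h]
    exact ⟨lam, hmem, h1, fun lam' h' h1' =>
      (Splus_strictAntiOn hR hθ hlt hd hdpos k).injOn h' hmem (h1'.trans h1.symm), rfl⟩
  · exact ⟨∅, by rw [PlusPhase, if_neg h], finite_empty⟩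

theorem exists_minusPhase (k : Fin K) : ∃ B, MinusPhase R θ d k B ∧ B.Finite := by
  by_cases h : 1 ≤ Splus R θ d k (lamLow R θ d)
  · have hfin := Sminus_roots_finite hR hθ hlt hd hdpos k
    refine ⟨{v | ∃ lam ∈ hfin.toFinset, v = candMinus R θ d k lam}, ?_, ?_⟩
    · rw [MinusPhase, if_pos h]
      exact ⟨hfin.toFinset, fun lam => by simp, rfl⟩
    · refine (hfin.toFinset.finite_toSet.image (candMinus R θ d k)).subset ?_
      rintro v ⟨lam, hl, rfl⟩
      exact ⟨lam, hl, rfl⟩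
  · exact ⟨∅, by rw [MinusPhase, if_neg h], finite_empty⟩

theorem exists_round {k : Fin K} (hk : (k : ℕ) + 1 ≤ ellORA R θ d) :
    ∃ w, Round R θ d k w := by
  obtain ⟨A, hA, hAf⟩ := exists_plusPhase hR hθ hlt hd hdpos hk
  obtain ⟨B, hB, hBf⟩ := exists_minusPhase hR hθ hlt hd hdpos k
  by_cases h : A ∪ B = ∅
  · exact ⟨0, A, B, hA, hB, by rw [if_pos h]⟩
  · obtain ⟨w, hw, hmax⟩ := Set.exists_max_image (A ∪ B) (T R θ d) (hAf.union hBf)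
      (nonempty_iff_ne_empty.2 h)
    exact ⟨w, A, B, hA, hB, by rw [if_neg h]; exact ⟨hw, hmax⟩⟩

theorem one_le_ellORA : ((0 : Fin K) : ℕ) + 1 ≤ ellORA R θ d := by
  rw [← lamLow_le_lamUpp_iff hR hθ hlt hd, lamLow_eq hR, lamUpp_eq]
  exact mul_le_mul_of_nonneg_right (U_one_lt_M hR hθ hlt).le (rate_mul_pos hR hθ hdpos 0).le

theorem exists_algorithmReturns : ∃ v, AlgorithmReturns R θ d v := by
  classical
  have hw : ∀ k : Fin K, ∃ w, (k = 0 → w = e1) ∧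
      (2 ≤ (k : ℕ) + 1 → (k : ℕ) + 1 ≤ ellORA R θ d → Round R θ d k w) := fun k => by
    by_cases hk0 : k = 0
    · exact ⟨e1, fun _ => rfl, fun h => by simp [hk0] at h⟩
    · by_cases hk : (k : ℕ) + 1 ≤ ellORA R θ d
      · obtain ⟨w, hw⟩ := exists_round hR hθ hlt hd hdpos hk
        exact ⟨w, fun h => absurd h hk0, fun _ _ => hw⟩
      -- Rounds beyond ℓ_ORA are never run; 0 is a filler.
      · exact ⟨0, fun h => absurd h hk0, fun _ h => absurd h hk⟩
  choose w hw0 hw using hw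
  obtain ⟨k, hk, hmax⟩ := Finset.exists_max_image
    (Finset.univ.filter fun k : Fin K => (k : ℕ) + 1 ≤ ellORA R θ d) (fun k => T R θ d (w k))
    ⟨0, Finset.mem_filter.2 ⟨Finset.mem_univ _, one_le_ellORA hR hθ hlt hd hdpos⟩⟩
  refine ⟨w k, ?_⟩
  rw [AlgorithmReturns, if_neg hlt.not_ge]
  exact ⟨w, hw, hw0 0 rfl, k, by simpa using hk, rfl, fun j hj => hmax j (by simpa using hj)⟩

theorem PlusPhase.subset_stdSimplex {k : Fin K} {A : Set (Fin K → ℝ)}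
    (hA : PlusPhase R θ d k A) : A ⊆ stdSimplex ℝ (Fin K) := by
  unfold PlusPhase at hA
  split_ifs at hA with h
  · obtain ⟨lam, hmem, h1, -, rfl⟩ := hA
    exact singleton_subset_iff.2 (candPlus_mem hR hθ hlt hd hdpos hmem h1)
  · rw [hA]; exact empty_subset _

theorem MinusPhase.subset_stdSimplex {k : Fin K} {B : Set (Fin K → ℝ)}
    (hB : MinusPhase R θ d k B) : B ⊆ stdSimplex ℝ (Fin K) := by
  unfold MinusPhase at hB
  split_ifs at hB with h
  · obtain ⟨roots, hroots, rfl⟩ := hB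
    rintro v ⟨lam, hl, rfl⟩
    obtain ⟨hmem, h1⟩ := (hroots lam).1 hl
    exact candMinus_mem hR hθ hlt hd hdpos hmem h1
  · rw [hB]; exact empty_subset _

theorem PlusPhase.candPlus_mem {k : Fin K} {A : Set (Fin K → ℝ)} (hA : PlusPhase R θ d k A)
    {lam : ℝ} (hmem : lam ∈ lamRange R θ d k) (h1 : Splus R θ d k lam = 1) :
    candPlus R θ d k lam ∈ A := by
  have hanti := (Splus_strictAntiOn hR hθ hlt hd hdpos k).antitoneOn
  have hk : lamLow R θ d ≤ lamUpp R θ d k := hmem.1.trans hmem.2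
  -- Monotonicity of S⁺ turns the existence of a root into both endpoint inequalities of the test.
  rw [PlusPhase, if_pos ⟨h1 ▸ hanti ⟨le_rfl, hk⟩ hmem hmem.1,
    h1 ▸ hanti hmem ⟨hk, le_rfl⟩ hmem.2⟩] at hA
  obtain ⟨lam', -, -, huniq, rfl⟩ := hA
  rw [huniq lam hmem h1]
  rfl

theorem MinusPhase.candMinus_mem {k : Fin K} {B : Set (Fin K → ℝ)} (hB : MinusPhase R θ d k B)
    {lam : ℝ} (hmem : lam ∈ lamRange R θ d k) (h1 : Sminus R θ d k lam = 1) :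
    candMinus R θ d k lam ∈ B := by
  have hanti := (Splus_strictAntiOn hR hθ hlt hd hdpos k).antitoneOn
  have hk : lamLow R θ d ≤ lamUpp R θ d k := hmem.1.trans hmem.2
  rw [MinusPhase, if_pos (h1 ▸ (Sminus_le_Splus hR hθ hlt hd hdpos hmem).trans
    (hanti ⟨le_rfl, hk⟩ hmem hmem.1))] at hB
  obtain ⟨roots, hroots, rfl⟩ := hB
  exact ⟨lam, (hroots lam).2 ⟨hmem, h1⟩, rfl⟩

theorem Round.eq_zero_or_mem {k : Fin K} {w : Fin K → ℝ} (hw : Round R θ d k w) :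
    w = 0 ∨ w ∈ stdSimplex ℝ (Fin K) := by
  obtain ⟨A, B, hA, hB, h⟩ := hw
  split_ifs at h with he
  · exact Or.inl h
  · exact Or.inr (h.1.elim
      (fun h => hA.subset_stdSimplex hR hθ hlt hd hdpos h)
      (fun h => hB.subset_stdSimplex hR hθ hlt hd hdpos h))

/-- Round `k` finds a vector at least as good as any maximizer that is one of its candidates. -/
theorem Round.T_le {k : Fin K} {w v : Fin K → ℝ} (hw : Round R θ d k w) {lam : ℝ}
    (hmem : lam ∈ lamRange R θ d k)
    (hv : v = candPlus R θ d k lam ∨ v = candMinus R θ d k lam) (hsum : ∑ i, v i = 1) :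
    T R θ d v ≤ T R θ d w := by
  obtain ⟨A, B, hA, hB, h⟩ := hw
  have hvAB : v ∈ A ∪ B := by
    rcases hv with rfl | rfl
    · exact Or.inl (hA.candPlus_mem hR hθ hlt hd hdpos hmem (by rw [← sum_candPlus, hsum]))
    · exact Or.inr (hB.candMinus_mem hR hθ hlt hd hdpos hmem (by rw [← sum_candMinus, hsum]))
  rw [if_neg (nonempty_iff_ne_empty.1 ⟨v, hvAB⟩)] at h
  exact h.2 hvAB

/-- Some maximizer exists, and it is (1, 0, …, 0) or a candidate of some round, so the output is at
least as good. -/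
theorem AlgorithmReturns.isMaximizer {v : Fin K → ℝ} (h : AlgorithmReturns R θ d v) :
    IsMaximizer R θ d v := by
  rw [AlgorithmReturns, if_neg hlt.not_ge] at h
  obtain ⟨w, hround, hw0, k, hk, rfl, hmax⟩ := h
  have he1 : T R θ d e1 ≤ T R θ d (w k) :=
    hw0 ▸ hmax 0 (one_le_ellORA hR hθ hlt hd hdpos)
  have hfeas : w k ∈ stdSimplex ℝ (Fin K) := by
    by_cases hk0 : k = 0
    · rw [hk0, hw0]; exact e1_mem
    · have hk0' : 0 < (k : ℕ) := Fin.pos_iff_ne_zero.2 hk0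
      -- The zero vector of an empty round is infeasible, but it cannot win because T(1, 0, …, 0) >
      -- 0.
      refine ((hround k (by omega) hk).eq_zero_or_mem hR hθ hlt hd hdpos).resolve_left fun h => ?_
      rw [h, T_zero] at he1
      exact (T_e1_pos hdpos).not_ge he1
  obtain ⟨u, hu⟩ := exists_isMaximizer hR hθ d
  have hle : T R θ d u ≤ T R θ d (w k) := by
    rcases hu.eq_e1_or_cand hR hθ hlt hd hdpos with rfl | ⟨j, lam, hj2, hj, hmem, hform, -⟩
    · exact he1
    · exact ((hround j hj2 hj).T_le hR hθ hlt hd hdpos hmem hform hu.1.2).trans (hmax j hj)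
  exact ⟨hfeas, fun x hx => (hu.2 hx).trans hle⟩

end Algorithm

end ORA

theorem mainTheorem8 {K : ℕ} [NeZero K] (hK : 2 ≤ K) (R θ : ℝ) (hR : 0 < R) (hθ : 0 < θ)
    (d : Fin K → ℝ) (hd : StrictAnti d) (hdpos : ∀ i, 0 < d i) :
    -- the functions used by the algorithm are well defined whenever they are used
    (θ < ORA.thetaC R →
      IsGreatest (ORA.U R θ '' Set.Icc 0 1) (ORA.M R θ) ∧
      (∃! v, v ∈ Set.Icc (0 : ℝ) 1 ∧ ORA.U R θ v = ORA.M R θ) ∧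
      ∀ C ∈ Set.Icc ((2 : ℝ) ^ R * Real.exp (-θ)) (ORA.M R θ),
        (∃! v, v ∈ Set.Icc (ORA.vInt R θ) 1 ∧ ORA.U R θ v = C) ∧
        (∃! v, v ∈ Set.Icc 0 (ORA.vInt R θ) ∧ ORA.U R θ v = C)) ∧
    -- the algorithm returns a vector, and whatever it returns is a global maximizer
    (∃ v, ORA.AlgorithmReturns R θ d v) ∧
    (∀ v, ORA.AlgorithmReturns R θ d v → ORA.IsMaximizer R θ d v) ∧
    -- form of every global maximizer
    (∀ v, ORA.IsMaximizer R θ d v →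
      v = ORA.e1 ∨
      ∃ (k : Fin K) (lam : ℝ), 2 ≤ (k : ℕ) + 1 ∧ (k : ℕ) + 1 ≤ ORA.ellORA R θ d ∧
        lam ∈ Set.Icc (ORA.lamLow R θ d) (ORA.lamUpp R θ d k) ∧
        (v = ORA.candPlus R θ d k lam ∨ v = ORA.candMinus R θ d k lam) ∧
        ∑ i ∈ Finset.Iic k, v i = 1) := by
  refine ⟨fun hlt => ?_, ?_, fun v hv => ?_, fun v hv => ?_⟩
  · obtain ⟨hp0, hp1, -, hM, hgr, huniq⟩ := ORA.vInt_spec hR hθ hlt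
    refine ⟨hgr, ⟨_, ⟨⟨hp0.le, hp1.le⟩, hM.symm⟩, fun v hv => huniq v hv.1 hv.2⟩, fun C hC => ?_⟩
    rw [← ORA.U_one R θ hR] at hC
    exact ⟨ORA.existsUnique_right hR hθ hlt hC,
      ORA.existsUnique_left hR hθ hlt ⟨(ORA.U_pos one_pos).le.trans hC.1, hC.2⟩⟩
  · rcases lt_or_ge θ (ORA.thetaC R) with hlt | hge
    · exact ORA.exists_algorithmReturns hR hθ hlt hd hdpos
    · exact ⟨ORA.e1, by rw [ORA.AlgorithmReturns, if_pos hge]⟩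
  · rcases lt_or_ge θ (ORA.thetaC R) with hlt | hge
    · exact hv.isMaximizer hR hθ hlt hd hdpos
    · rw [ORA.AlgorithmReturns, if_pos hge] at hv
      obtain ⟨u, hu⟩ := ORA.exists_isMaximizer hR hθ d
      rwa [hv, ← hu.eq_e1_of_thetaC_le hR hθ hd hdpos hge]
  · rcases lt_or_ge θ (ORA.thetaC R) with hlt | hge
    · exact hv.eq_e1_or_cand hR hθ hlt hd hdpos
    · exact Or.inl (hv.eq_e1_of_thetaC_le hR hθ hd hdpos hge)
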